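/- Write $\mathbb N=\{1,2,3,\dots\}$. For $g\in\mathbb Z[T]$ let $V_g$ be the set of primes $p$ for which the congruence $g(T)\equiv 0 \pmod p$ has a solution, and call a set of primes a \emph{Frobenius set} if it belongs to the Boolean algebra of sets of primes generated by the sets $V_g$, $g\in\mathbb Z[T]$. For a monic $h\in\mathbb Z[T]$ and $M>0$ let $S(h;M)$ be the set of pairs $(p,f)$ such that $p>M$ is prime, $f\in\mathbb N$, and the reduction of $h$ modulo $p$ has a root in the field $\mathbb F_{p^f}$. **Proposition.** Let $h(T)\in\mathbb Z[T]$ be monic. Then there exists an integer $M_0>0$, depending only on $h$, such that $$S(h;M_0)=\bigcup_{i=1}^r \mathcal P_i\times\mathcal N_i$$ for some $r\in\mathbb N$, where (a) the sets $\mathcal P_1,\dots,\mathcal P_r$ are Frobenius sets and form a partition of the set of primes $p>M_0$ (they are non-empty, pairwise disjoint, and their union is the set of all primes $p>M_0$); (b) each $\mathcal N_i$ is a finite (possibly empty) union of sets of the form $k\mathbb N=\{k,2k,3k,\dots\}$ with $k\in\mathbb N$. -/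

import Mathlib

/-- `V_g`: the set of primes `p` for which the congruence `g(T) ≡ 0 (mod p)` has a solution. -/
def primesWithRoot (g : Polynomial ℤ) : Set Nat.Primes :=
  {p | ∃ t : ℤ, g.eval t ≡ 0 [ZMOD ((p : ℕ) : ℤ)]}

/-- A set of primes is a Frobenius set if it is in the Boolean algebra (of sets of primes)
generated by the sets `V_g`, where `g` ranges over all polynomials in `ℤ[T]`. -/
def IsFrobeniusSet (P : Set Nat.Primes) : Prop :=
  P ∈ BooleanSubalgebra.closure (Set.range primesWithRoot)

/-- The reduction modulo `p` of `h` has a root in the field with `p ^ f` elements (`1 ≤ f`). -/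
def HasRootInGaloisField (h : Polynomial ℤ) (p : Nat.Primes) (f : ℕ) : Prop :=
  haveI : Fact (p : ℕ).Prime := ⟨p.2⟩
  ∃ x : GaloisField (p : ℕ) f,
    Polynomial.aeval x (h.map (Int.castRingHom (ZMod (p : ℕ)))) = 0

/-- `S(h; M)`: the pairs `(p, f)` with `p > M` prime, `f ≥ 1`, such that the reduction of `h`
modulo `p` has a root in the field with `p ^ f` elements. -/
def rootPairs (h : Polynomial ℤ) (M : ℕ) : Set (Nat.Primes × ℕ) :=
  {x | M < (x.1 : ℕ) ∧ 1 ≤ x.2 ∧ HasRootInGaloisField h x.1 x.2}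

/-- The set `k ℕ = {k, 2k, 3k, …}`, where `ℕ` is the set of positive integers. -/
def positiveMultiples (k : ℕ) : Set ℕ :=
  {m | ∃ n : ℕ, 1 ≤ n ∧ m = k * n}

/-! Let `K` be the splitting field of `h`, with ring of integers `𝓞 K` and Galois group `G`, and let
`σ` be a Frobenius element at `p`. For all but finitely many `p` the roots of `h` in `𝓞 K` stay
distinct modulo the primes above `p`, so `h` has a root in `𝔽_{p^f}` iff `σ ^ f` fixes a root.
This happens iff `σ` is conjugate into `⟨τ⟩` for some `τ : G` having a root on a cycle of length
dividing `f`. Pick `θ ∈ 𝓞 K` with stabilizer `⟨τ⟩`, and let `g_τ ∈ ℤ[T]` have the conjugates of `θ`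
as roots: for almost all `p`, the condition on `σ` says that `g_τ` has a root modulo `p`. Hence,
above some bound, `S(h; M)` is a finite union of sets `V_{g_i} × k_i ℕ`, and cutting the primes
according to the pattern `{i | p ∈ V_{g_i}}` yields the decomposition. -/

open Polynomial

local instance (p : Nat.Primes) : Fact (p : ℕ).Prime := ⟨p.2⟩

section FiniteFields

theorem exists_common_root_iff_not_isCoprime {F L : Type*} [Field F] [CommRing L]
    [IsDomain L] [Algebra F L] {q : F[X]} (hq : q ≠ 0) (hs : (q.map (algebraMap F L)).Splits)
    (h : F[X]) :
    (∃ y : L, aeval y q = 0 ∧ aeval y h = 0) ↔ ¬ IsCoprime q h := by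
  constructor
  · rintro ⟨y, hqy, hhy⟩ ⟨u, v, huv⟩
    simpa [hqy, hhy] using congrArg (aeval y) huv
  · intro hqh
    obtain ⟨d, hdq, hdh, hd⟩ : ∃ d, d ∣ q ∧ d ∣ h ∧ ¬ IsUnit d := by
      simpa [← isRelPrime_iff_isCoprime, IsRelPrime] using hqh
    have hds : (d.map (algebraMap F L)).Splits :=
      hs.of_dvd (Polynomial.map_ne_zero hq) (Polynomial.map_dvd _ hdq)
    obtain ⟨y, hy⟩ := hds.exists_eval_eq_zero (by
      rwa [degree_map, Ne, ← isUnit_iff_degree_eq_zero])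
    rw [eval_map_algebraMap] at hy
    exact ⟨y, aeval_eq_zero_of_dvd_aeval_eq_zero hdq hy,
      aeval_eq_zero_of_dvd_aeval_eq_zero hdh hy⟩

variable {p : Nat.Primes} {h : ℤ[X]} {f : ℕ}

theorem hasRootInGaloisField_iff_not_isCoprime (hf : f ≠ 0) :
    HasRootInGaloisField h p f ↔
      ¬ IsCoprime (X ^ (p : ℕ) ^ f - X : (ZMod p)[X]) (h.map (algebraMap ℤ (ZMod p))) := by
  have hq := FiniteField.X_pow_card_pow_sub_X_ne_zero (ZMod p) hf p.2.one_lt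
  have hfix (x : GaloisField p f) : aeval x (X ^ (p : ℕ) ^ f - X : (ZMod p)[X]) = 0 := by
    have := Fintype.ofFinite (GaloisField p f)
    have hcard : Fintype.card (GaloisField p f) = (p : ℕ) ^ f := by
      rw [← Nat.card_eq_fintype_card, GaloisField.card p f hf]
    rw [map_sub, map_pow, aeval_X, ← hcard, FiniteField.pow_card, sub_self]
  exact (exists_congr fun x => (and_iff_right (hfix x)).symm).trans
    (exists_common_root_iff_not_isCoprime hq (SplittingField.splits _) _)

theorem hasRootInGaloisField_iff_exists_pow_eq (hm : h.Monic) (hf : f ≠ 0) {k : Type*}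
    [CommRing k] [IsDomain k] [CharP k p] (hs : (h.map (algebraMap ℤ k)).Splits) :
    HasRootInGaloisField h p f ↔ ∃ y ∈ h.rootSet k, y ^ (p : ℕ) ^ f = y := by
  let _ : Algebra (ZMod p) k := ZMod.algebra k p
  have hs' : ((h.map (algebraMap ℤ (ZMod p))).map (algebraMap (ZMod p) k)).Splits := by
    rwa [Polynomial.map_map, ← IsScalarTower.algebraMap_eq]
  rw [hasRootInGaloisField_iff_not_isCoprime hf, isCoprime_comm,
    ← exists_common_root_iff_not_isCoprime (hm.map _).ne_zero hs']
  simp only [hm.mem_rootSet, aeval_map_algebraMap, map_sub, map_pow, aeval_X, sub_eq_zero]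

theorem mem_primesWithRoot_iff_hasRootInGaloisField_one :
    p ∈ primesWithRoot h ↔ HasRootInGaloisField h p 1 := by
  have hfix (x : ZMod p) : aeval x (X ^ (p : ℕ) - X : (ZMod p)[X]) = 0 := by simp
  have hs : ((X ^ (p : ℕ) - X : (ZMod p)[X]).map (algebraMap (ZMod p) (ZMod p))).Splits := by
    simpa [ZMod.card] using FiniteField.splits_X_pow_card_sub_X (p := p) (K := ZMod p)
  rw [hasRootInGaloisField_iff_not_isCoprime one_ne_zero, pow_one,
    ← exists_common_root_iff_not_isCoprime
      (FiniteField.X_pow_card_sub_X_ne_zero _ p.2.one_lt) hs]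
  simp only [hfix, true_and, aeval_map_algebraMap, primesWithRoot, Set.mem_ofPred_eq,
    ← ZMod.intCast_eq_intCast_iff, Int.cast_zero, (ZMod.intCast_surjective).exists]
  refine exists_congr fun t => ?_
  rw [← eq_intCast (algebraMap ℤ (ZMod p)) t, aeval_algebraMap_apply, eq_intCast, coe_aeval_eq_eval]

end FiniteFields

section FrobeniusElements

/-- `σ` is a Frobenius element over the prime number `p`: it induces `x ↦ x ^ p` modulo some
maximal ideal of `R` lying over `p`. -/
def IsFrobeniusElement (R : Type*) {G : Type*} [CommRing R] [Group G] [MulSemiringAction G R]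
    (p : Nat.Primes) (σ : G) : Prop :=
  ∃ Q : Ideal R, Q.IsMaximal ∧ Q.LiesOver (Ideal.span {(p : ℤ)}) ∧ IsArithFrobAt ℤ σ Q

theorem exists_isFrobeniusElement (R G : Type*) [CommRing R] [IsDomain R] [CharZero R] [Group G]
    [Finite G] [MulSemiringAction G R] [Algebra.IsInvariant ℤ R G] (p : Nat.Primes) :
    ∃ σ : G, IsFrobeniusElement R p σ := by
  have := Algebra.IsInvariant.isIntegral ℤ R G
  obtain ⟨Q, hQ, hQp⟩ := Ideal.exists_maximal_ideal_liesOver_of_isIntegral (S := R)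
    (Ideal.span {(p : ℤ)})
  let _ := Ideal.Quotient.field (Ideal.span {(p : ℤ)})
  let _ := Ideal.Quotient.field Q
  have := Ideal.Quotient.finite_of_isInvariant G (Ideal.span {(p : ℤ)}) Q
  have : Finite (R ⧸ Q) := Module.finite_of_finite (ℤ ⧸ Ideal.span {(p : ℤ)})
  exact (IsArithFrobAt.exists_of_isInvariant ℤ G Q).imp fun σ hσ => ⟨Q, hQ, hQp, hσ⟩

variable {R G : Type*} [CommRing R] [Group G] [MulSemiringAction G R] {σ : G}

theorem charP_quotient_of_liesOver (Q : Ideal R) (n : ℕ) [hQ : Q.LiesOver (Ideal.span {(n : ℤ)})] :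
    CharP (R ⧸ Q) n where
  cast_eq_zero_iff m := by
    rw [← Int.natCast_dvd_natCast, ← Ideal.mem_span_singleton, hQ.over, Ideal.mem_comap,
      ← Ideal.Quotient.eq_zero_iff_mem]
    simp

theorem mk_pow_smul_of_isArithFrobAt {Q : Ideal R} {n : ℕ} [hQ : Q.LiesOver (Ideal.span {(n : ℤ)})]
    (hσ : IsArithFrobAt ℤ σ Q) (f : ℕ) (x : R) :
    Ideal.Quotient.mk Q (σ ^ f • x) = Ideal.Quotient.mk Q x ^ n ^ f := by
  induction f with
  | zero => simp
  | succ f ih =>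
    have hmk : Ideal.Quotient.mk Q (σ • σ ^ f • x) = Ideal.Quotient.mk Q (σ ^ f • x) ^ n := by
      simpa [← hQ.over, Int.card_ideal_quot] using hσ.mk_apply (σ ^ f • x)
    rw [pow_succ' σ, mul_smul, hmk, ih, ← pow_mul, ← pow_succ]

theorem eventually_injOn_quotient_mk [IsDomain R] [CharZero R] [Algebra.IsAlgebraic ℤ R] {S : Set R}
    (hS : S.Finite) : ∀ᶠ p : Nat.Primes in Filter.cofinite, ∀ Q : Ideal R,
      Q.LiesOver (Ideal.span {((p : ℕ) : ℤ)}) → S.InjOn (Ideal.Quotient.mk Q) := by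
  obtain ⟨N, hN, hdvd⟩ : ∃ N : ℤ, N ≠ 0 ∧
      ∏ z ∈ hS.toFinset.offDiag, (z.1 - z.2) ∣ algebraMap ℤ R N :=
    (Algebra.IsAlgebraic.isAlgebraic _).exists_nonzero_dvd <| mem_nonZeroDivisors_of_ne_zero <|
      Finset.prod_ne_zero_iff.2 fun z hz => sub_ne_zero.2 (Finset.mem_offDiag.1 hz).2.2
  have hfin : {p : Nat.Primes | ((p : ℕ) : ℤ) ∣ N}.Finite := by
    refine (N.natAbs.divisors.finite_toSet.preimage
      Nat.Primes.coe_nat_injective.injOn).subset fun p hp => ?_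
    simpa [hN] using Int.natCast_dvd.1 hp
  filter_upwards [hfin.compl_mem_cofinite] with p hp Q hQ x hx y hy hxy
  by_contra hne
  refine hp ?_
  have hNQ : algebraMap ℤ R N ∈ Q := Q.mem_of_dvd hdvd <|
    Q.mem_of_dvd (Finset.dvd_prod_of_mem _ (a := (x, y)) (by simp [hx, hy, hne]))
      (Ideal.Quotient.eq.1 hxy)
  rwa [← Ideal.mem_comap, ← Ideal.under_def, ← hQ.over, Ideal.mem_span_singleton] at hNQ

theorem eventually_hasRootInGaloisField_iff [IsDomain R] [CharZero R] [Algebra.IsAlgebraic ℤ R]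
    {h : ℤ[X]} (hm : h.Monic) (hs : (h.map (algebraMap ℤ R)).Splits) :
    ∀ᶠ p : Nat.Primes in Filter.cofinite, ∀ σ : G, IsFrobeniusElement R p σ → ∀ f ≠ 0,
      (HasRootInGaloisField h p f ↔ ∃ x ∈ h.rootSet R, σ ^ f • x = x) := by
  filter_upwards [eventually_injOn_quotient_mk (h.rootSet_finite R)]
    with p hinj σ ⟨Q, hQ, hQp, hσ⟩ f hf
  have := charP_quotient_of_liesOver Q p
  have hmap : (h.map (algebraMap ℤ R)).map (Ideal.Quotient.mk Q) =
      h.map (algebraMap ℤ (R ⧸ Q)) := by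
    rw [Polynomial.map_map, RingHom.ext_int (algebraMap ℤ (R ⧸ Q))]
  have hfix {x : R} (hx : x ∈ h.rootSet R) : σ ^ f • x = x ↔
      Ideal.Quotient.mk Q x ^ (p : ℕ) ^ f = Ideal.Quotient.mk Q x := by
    rw [← mk_pow_smul_of_isArithFrobAt hσ, (hinj Q hQp).eq_iff (smul_mem_rootSet _ hx) hx]
  rw [hasRootInGaloisField_iff_exists_pow_eq hm hf (hmap ▸ hs.map (Ideal.Quotient.mk Q)),
    ← hs.image_rootSet_of_map_ne_zero (Ideal.Quotient.mk Q).toIntAlgHom (hm.map _).ne_zero,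
    Set.exists_mem_image]
  exact exists_congr fun x => and_congr_right fun hx => (hfix hx).symm

theorem eventually_mem_primesWithRoot_iff [IsDomain R] [CharZero R] [Algebra.IsAlgebraic ℤ R]
    {h : ℤ[X]} (hm : h.Monic) (hs : (h.map (algebraMap ℤ R)).Splits) :
    ∀ᶠ p : Nat.Primes in Filter.cofinite, ∀ σ : G, IsFrobeniusElement R p σ →
      (p ∈ primesWithRoot h ↔ ∃ x ∈ h.rootSet R, σ • x = x) := by
  filter_upwards [eventually_hasRootInGaloisField_iff (G := G) hm hs] with p hp σ hσ
  rw [mem_primesWithRoot_iff_hasRootInGaloisField_one, hp σ hσ 1 one_ne_zero, pow_one]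

end FrobeniusElements

section Stabilizers

open MulAction NumberField IntermediateField

theorem fixingSubgroup_adjoin_simple {F E : Type*} [Field F] [Field E] [Algebra F E] (α : E) :
    F⟮α⟯.fixingSubgroup = stabilizer Gal(E/F) α := by
  ext σ
  rw [← Subgroup.zpowers_le, ← IntermediateField.le_iff_le, adjoin_simple_le_iff,
    mem_fixedField_iff, ← Subgroup.zpowers_le]
  rfl

theorem exists_stabilizer_gal_eq {F E : Type*} [Field F] [Field E] [Algebra F E]
    [FiniteDimensional F E] [Algebra.IsSeparable F E] (H : Subgroup Gal(E/F)) :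
    ∃ α : E, stabilizer Gal(E/F) α = H := by
  obtain ⟨α, hα⟩ := Field.exists_primitive_element F (fixedField H)
  refine ⟨α, ?_⟩
  rw [← fixingSubgroup_adjoin_simple, ← lift_adjoin_simple, hα, lift_top, fixingSubgroup_fixedField]

theorem exists_stabilizer_ringOfIntegers_eq {K : Type*} [Field K] [NumberField K]
    (H : Subgroup Gal(K/ℚ)) : ∃ θ : 𝓞 K, stabilizer Gal(K/ℚ) θ = H := by
  obtain ⟨α, hα⟩ := exists_stabilizer_gal_eq H
  obtain ⟨n, hn, hint⟩ := ((IsFractionRing.isAlgebraic_iff ℤ ℚ K).2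
    (Algebra.IsAlgebraic.isAlgebraic α)).exists_integral_multiple
  obtain ⟨θ, hθ⟩ : ∃ θ : 𝓞 K, algebraMap (𝓞 K) K θ = n • α := ⟨⟨n • α, hint⟩, rfl⟩
  refine ⟨θ, hα ▸ Subgroup.ext fun σ => ?_⟩
  rw [mem_stabilizer_iff, mem_stabilizer_iff, ← RingOfIntegers.coe_injective.eq_iff,
    algebraMap.smul', hθ, smul_comm, smul_right_inj hn]

theorem exists_monic_splits_rootSet_eq_orbit {A B : Type*} (G : Type*) [CommRing A] [CommRing B]
    [IsDomain B] [Algebra A B] [Group G] [Finite G] [MulSemiringAction G B]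
    [Algebra.IsInvariant A B G] (b : B) :
    ∃ g : A[X], g.Monic ∧ (g.map (algebraMap A B)).Splits ∧ g.rootSet B = orbit G b := by
  have := Fintype.ofFinite G
  obtain ⟨g, hg, -, hm⟩ := lifts_and_natDegree_eq_and_monic
    (Algebra.IsInvariant.charpoly_mem_lifts A B G b) (MulSemiringAction.monic_charpoly G b)
  refine ⟨g, hm, hg ▸ MulSemiringAction.splits_charpoly G b, ?_⟩
  ext x
  rw [hm.mem_rootSet, ← eval_map_algebraMap, hg, MulSemiringAction.charpoly_eq, eval_prod,
    Finset.prod_eq_zero_iff]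
  simp [sub_eq_zero, mem_orbit_iff, eq_comm]

end Stabilizers

section GroupActions

open MulAction

variable {G X : Type*} [Group G] [MulAction G X] {σ : G}

theorem exists_mem_orbit_smul_eq_iff {θ : X} :
    (∃ x ∈ orbit G θ, σ • x = x) ↔ ∃ ρ : G, ρ * σ * ρ⁻¹ ∈ stabilizer G θ := by
  rw [← (Equiv.inv G).exists_congr_right]
  simp [mem_orbit_iff, mul_smul, inv_smul_eq_iff]

theorem exists_pow_smul_eq_iff {f : ℕ} :
    (∃ x : X, σ ^ f • x = x) ↔
      ∃ (τ : G) (x : X), (∃ ρ : G, ρ * σ * ρ⁻¹ ∈ Subgroup.zpowers τ) ∧ period τ x ∣ f := by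
  simp_rw [← pow_smul_eq_iff_period_dvd]
  constructor
  · rintro ⟨x, hx⟩
    exact ⟨σ, x, ⟨1, by simp⟩, hx⟩
  · rintro ⟨τ, x, ⟨ρ, n, hn⟩, hx⟩
    have hσ : ρ * σ ^ f * ρ⁻¹ = (τ ^ f) ^ n := by
      rw [← conj_pow, ← hn, ← zpow_natCast, ← zpow_natCast, zpow_comm]
    have hfix : ρ * σ ^ f * ρ⁻¹ ∈ stabilizer G x := hσ ▸ zpow_mem (mem_stabilizer_iff.2 hx) n
    refine ⟨ρ⁻¹ • x, ?_⟩
    rwa [mem_stabilizer_iff, mul_smul, mul_smul, ← eq_inv_smul_iff] at hfix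

end GroupActions

section NumberFields

open MulAction NumberField

theorem exists_eventually_mem_primesWithRoot_iff {K : Type*} [Field K] [NumberField K]
    [IsGalois ℚ K] (H : Subgroup Gal(K/ℚ)) :
    ∃ g : ℤ[X], ∀ᶠ p : Nat.Primes in Filter.cofinite, ∀ σ : Gal(K/ℚ),
      IsFrobeniusElement (𝓞 K) p σ → (p ∈ primesWithRoot g ↔ ∃ ρ, ρ * σ * ρ⁻¹ ∈ H) := by
  obtain ⟨θ, hθ⟩ := exists_stabilizer_ringOfIntegers_eq H
  obtain ⟨g, hm, hs, hroots⟩ := exists_monic_splits_rootSet_eq_orbit (A := ℤ) Gal(K/ℚ) θ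
  refine ⟨g, (eventually_mem_primesWithRoot_iff (G := Gal(K/ℚ)) hm hs).mono fun p hp σ hσ => ?_⟩
  rw [hp σ hσ, hroots, exists_mem_orbit_smul_eq_iff, hθ]

theorem splits_map_ringOfIntegers {K : Type*} [Field K] {h : ℤ[X]}
    (hm : h.Monic) (hs : (h.map (algebraMap ℤ K)).Splits) :
    (h.map (algebraMap ℤ (𝓞 K))).Splits := by
  have hmap : (h.map (algebraMap ℤ (𝓞 K))).map (algebraMap (𝓞 K) K) = h.map (algebraMap ℤ K) := by
    rw [Polynomial.map_map, ← IsScalarTower.algebraMap_eq]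
  refine Splits.of_splits_map_of_injective RingOfIntegers.coe_injective (hmap ▸ hs) fun x hx => ?_
  have hx0 : (h.map (algebraMap ℤ K)).IsRoot x := hmap ▸ isRoot_of_mem_roots hx
  exact ⟨⟨x, h, hm, by rwa [← eval_map]⟩, rfl⟩

theorem exists_eventually_hasRootInGaloisField_iff_of_splits (K : Type*) [Field K] [NumberField K]
    [IsGalois ℚ K] {h : ℤ[X]} (hm : h.Monic) (hs : (h.map (algebraMap ℤ (𝓞 K))).Splits) :
    ∃ (g : Gal(K/ℚ) → ℤ[X]), ∀ᶠ p : Nat.Primes in Filter.cofinite, ∀ f ≠ 0,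
      (HasRootInGaloisField h p f ↔
        ∃ (τ : Gal(K/ℚ)) (x : h.rootSet (𝓞 K)), p ∈ primesWithRoot (g τ) ∧ period τ x ∣ f) := by
  choose g hg using fun τ : Gal(K/ℚ) =>
    exists_eventually_mem_primesWithRoot_iff (Subgroup.zpowers τ)
  refine ⟨g, ?_⟩
  filter_upwards [eventually_hasRootInGaloisField_iff (G := Gal(K/ℚ)) hm hs,
    Filter.eventually_all.2 hg] with p hroot hmem f hf
  obtain ⟨σ, hσ⟩ := exists_isFrobeniusElement (𝓞 K) Gal(K/ℚ) p
  have hfix : (∃ x ∈ h.rootSet (𝓞 K), σ ^ f • x = x) ↔ ∃ x : h.rootSet (𝓞 K), σ ^ f • x = x := by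
    simp only [Subtype.exists, Subtype.ext_iff, rootSet.coe_smul, exists_prop]
  simp only [hroot σ hσ f hf, hmem _ σ hσ, hfix, exists_pow_smul_eq_iff, exists_and_left]

theorem exists_eventually_hasRootInGaloisField_iff {h : ℤ[X]} (hm : h.Monic) :
    ∃ (ι : Type) (_ : Finite ι) (g : ι → ℤ[X]) (k : ι → ℕ), (∀ i, 0 < k i) ∧
      ∀ᶠ p : Nat.Primes in Filter.cofinite, ∀ f ≠ 0,
        (HasRootInGaloisField h p f ↔ ∃ i, p ∈ primesWithRoot (g i) ∧ k i ∣ f) := by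
  let q : ℚ[X] := h.map (algebraMap ℤ ℚ)
  have : NumberField q.SplittingField := {}
  have : IsSplittingField ℚ q.SplittingField q := IsSplittingField.splittingField q
  have : IsGalois ℚ q.SplittingField := { to_normal := Normal.of_isSplittingField q }
  have hs : (h.map (algebraMap ℤ (𝓞 q.SplittingField))).Splits := splits_map_ringOfIntegers hm <| by
    rw [IsScalarTower.algebraMap_eq ℤ ℚ, ← Polynomial.map_map]
    exact SplittingField.splits q
  obtain ⟨g, hg⟩ := exists_eventually_hasRootInGaloisField_iff_of_splits q.SplittingField hm hs
  refine ⟨Gal(q.SplittingField/ℚ) × h.rootSet (𝓞 q.SplittingField), inferInstance,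
    fun i => g i.1, fun i => period i.1 i.2,
    fun i => period_pos_of_orderOf_pos (orderOf_pos _) _, ?_⟩
  simpa only [Prod.exists] using hg

end NumberFields

section FrobeniusSets

theorem isFrobeniusSet_primesWithRoot (g : ℤ[X]) : IsFrobeniusSet (primesWithRoot g) :=
  BooleanSubalgebra.subset_closure ⟨g, rfl⟩

theorem isFrobeniusSet_setOf_lt (M : ℕ) : IsFrobeniusSet {p : Nat.Primes | M < (p : ℕ)} := by
  have hcompl : {p : Nat.Primes | M < (p : ℕ)} = (primesWithRoot (C (M.factorial : ℤ)))ᶜ := by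
    ext p
    simp only [primesWithRoot, eval_C, Int.modEq_zero_iff_dvd, Int.natCast_dvd_natCast,
      p.2.dvd_factorial, exists_const, Set.mem_compl_iff, Set.mem_ofPred_eq, not_le]
  exact hcompl ▸ BooleanSubalgebra.compl_mem (isFrobeniusSet_primesWithRoot _)

theorem isFrobeniusSet_setOf_pattern_eq {ι : Type*} [Finite ι] {V : ι → Set Nat.Primes}
    (hV : ∀ i, IsFrobeniusSet (V i)) (A : Set ι) : IsFrobeniusSet {p | {i | p ∈ V i} = A} := by
  classical
  have hpattern : {p | {i | p ∈ V i} = A} = ⨅ i, if i ∈ A then V i else (V i)ᶜ := by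
    ext p
    simp only [Set.iInf_eq_iInter, Set.mem_iInter, Set.ext_iff, Set.mem_ofPred_eq]
    refine forall_congr' fun i => ?_
    split_ifs with hi <;> simp [hi]
  rw [hpattern]
  refine BooleanSubalgebra.iInf_mem fun i => ?_
  split_ifs
  exacts [hV i, BooleanSubalgebra.compl_mem (hV i)]

theorem exists_forall_lt_of_eventually_cofinite {q : Nat.Primes → Prop}
    (hq : ∀ᶠ p in Filter.cofinite, q p) : ∃ M : ℕ, 0 < M ∧ ∀ p : Nat.Primes, M < (p : ℕ) → q p := by
  obtain ⟨M, hM⟩ := (Filter.eventually_cofinite.1 hq).image ((↑) : Nat.Primes → ℕ) |>.bddAbove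
  refine ⟨M + 1, M.succ_pos, fun p hp => ?_⟩
  by_contra hqp
  have := hM ⟨p, hqp, rfl⟩
  lia

end FrobeniusSets

section Fibers

variable {α β γ : Type*} {φ : α → β} {s : Set α}

theorem exists_fin_partition_fibers (hs : (φ '' s).Finite) :
    ∃ (r : ℕ) (b : Fin r → β), (∀ i, (s ∩ φ ⁻¹' {b i}).Nonempty) ∧
      (∀ i j, i ≠ j → Disjoint (s ∩ φ ⁻¹' {b i}) (s ∩ φ ⁻¹' {b j})) ∧
      ⋃ i, s ∩ φ ⁻¹' {b i} = s := by
  obtain ⟨r, b, hb, hrange⟩ := hs.fin_param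
  refine ⟨r, b, fun i => hrange.subset ⟨i, rfl⟩, fun i j hij => ?_, ?_⟩
  · exact ((Set.disjoint_singleton.2 (hb.ne hij)).preimage φ).mono
      Set.inter_subset_right Set.inter_subset_right
  · rw [← Set.inter_iUnion, ← Set.preimage_iUnion, Set.iUnion_singleton_eq_range, hrange,
      Set.inter_eq_left]
    exact Set.subset_preimage_image φ s

theorem iUnion_fiber_prod {ι : Sort*} {b : ι → β} (hs : ⋃ i, s ∩ φ ⁻¹' {b i} = s) (N : β → Set γ) :
    ⋃ i, (s ∩ φ ⁻¹' {b i}) ×ˢ N (b i) = {x | x.1 ∈ s ∧ x.2 ∈ N (φ x.1)} := by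
  ext ⟨a, c⟩
  constructor
  · simp only [Set.mem_iUnion]
    rintro ⟨i, ⟨ha, hi⟩, hc⟩
    exact ⟨ha, by rwa [Set.mem_singleton_iff.1 hi]⟩
  · rintro ⟨ha, hc⟩
    obtain ⟨i, hi⟩ := Set.mem_iUnion.1 (hs.symm.subset ha)
    exact Set.mem_iUnion.2 ⟨i, hi, by rwa [← Set.mem_singleton_iff.1 hi.2]⟩

end Fibers

theorem mem_positiveMultiples {k m : ℕ} (hk : 0 < k) :
    m ∈ positiveMultiples k ↔ 1 ≤ m ∧ k ∣ m := by
  constructor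
  · rintro ⟨n, hn, rfl⟩
    exact ⟨Nat.mul_pos hk hn, dvd_mul_right k n⟩
  · rintro ⟨hm, n, rfl⟩
    exact ⟨n, Nat.pos_of_mul_pos_left hm, rfl⟩

theorem rootPairs_eq_setOf {ι : Type*} {h : ℤ[X]} {M : ℕ} {V : ι → Set Nat.Primes} {k : ι → ℕ}
    (hk : ∀ i, 0 < k i) (hroot : ∀ p : Nat.Primes, M < (p : ℕ) → ∀ f ≠ 0,
      (HasRootInGaloisField h p f ↔ ∃ i, p ∈ V i ∧ k i ∣ f)) :
    rootPairs h M = {x | M < (x.1 : ℕ) ∧ x.2 ∈ ⋃ i ∈ {i | x.1 ∈ V i}, positiveMultiples (k i)} := by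
  ext ⟨p, f⟩
  simp only [rootPairs, Set.mem_ofPred_eq, Set.mem_iUnion, exists_prop,
    mem_positiveMultiples (hk _)]
  refine and_congr_right fun hp =>
    (and_congr_right fun hf => hroot p hp f (Nat.one_le_iff_ne_zero.1 hf)).trans ?_
  simp only [← exists_and_left, and_left_comm]

theorem proposition2p4 (h : Polynomial ℤ) (hmonic : h.Monic) :
    ∃ M₀ : ℕ, 0 < M₀ ∧
      ∃ (r : ℕ) (P : Fin r → Set Nat.Primes) (N : Fin r → Set ℕ),
        rootPairs h M₀ = ⋃ i, P i ×ˢ N i ∧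
        -- (a) the `P i` partition the primes bigger than `M₀` into Frobenius sets
        ((∀ i, (P i).Nonempty) ∧
          (∀ i j, i ≠ j → Disjoint (P i) (P j)) ∧
          (⋃ i, P i) = {p : Nat.Primes | M₀ < (p : ℕ)} ∧
          ∀ i, IsFrobeniusSet (P i)) ∧
        -- (b) each `N i` is a finite union of sets `k ℕ` with `k ≥ 1`
        ∀ i, ∃ K : Finset ℕ, (∀ k ∈ K, 1 ≤ k) ∧ N i = ⋃ k ∈ K, positiveMultiples k := by
  obtain ⟨ι, _, g, k, hk, hev⟩ := exists_eventually_hasRootInGaloisField_iff hmonic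
  obtain ⟨M, hM, hroot⟩ := exists_forall_lt_of_eventually_cofinite hev
  obtain ⟨r, A, hne, hdisj, hunion⟩ := exists_fin_partition_fibers
    (φ := fun p : Nat.Primes => {i | p ∈ primesWithRoot (g i)}) (s := {p | M < (p : ℕ)})
    (Set.toFinite _)
  refine ⟨M, hM, r, _, fun i => ⋃ j ∈ A i, positiveMultiples (k j), ?_,
    ⟨hne, hdisj, hunion, fun i => ?_⟩, fun i => ?_⟩
  · exact (rootPairs_eq_setOf hk hroot).trans
      (iUnion_fiber_prod hunion fun B => ⋃ j ∈ B, positiveMultiples (k j)).symm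
  · exact BooleanSubalgebra.inf_mem (isFrobeniusSet_setOf_lt M)
      (isFrobeniusSet_setOf_pattern_eq (fun j => isFrobeniusSet_primesWithRoot (g j)) (A i))
  · refine ⟨(A i).toFinite.toFinset.image k, ?_, ?_⟩
    · exact Finset.forall_mem_image.2 fun j _ => hk j
    · simp
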